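/- **Notation.** Let $S$ be a semigroup and $z_0\in S$ a fixed element. For $T\subseteq S$ put $T^2=\{xy : x,y\in T\}$ and $T^2z_0=\{xyz_0 : x,y\in T\}$. A function $\chi:S\to\mathbb C$ is multiplicative if $\chi(xy)=\chi(x)\chi(y)$ for all $x,y \in S$; then $I_\chi=\{x\in S:\chi(x)=0\}$, and if $\chi\ne0$, then $S\setminus I_\chi$ is a subsemigroup of $S$. A function $A$ from a semigroup to $\mathbb C$ is additive if $A(xy)=A(x)+A(y)$ for all $x,y$. Put $$P_\chi=\{p\in I_\chi\setminus I_\chi^2 : up,\ pv,\ upv\in I_\chi\setminus I_\chi^2\ \text{for all } u,v\in S\setminus I_\chi\}.$$ For a non-zero multiplicative $\chi$, an additive $A:S\setminus I_\chi\to\mathbb C$ and a function $\rho:P_\chi\to\mathbb C$, let $\Psi_{A\chi,\rho}:S\to\mathbb C$ be the function equal to $\chi A$ on $S\setminus I_\chi$, to $\rho$ on $P_\chi$ and to $0$ on $I_\chi\setminus P_\chi$. Whenever it is used below, it is understood that $\Psi_{A\chi,\rho}\neq 0$ and that (I) $\Psi_{A\chi,\rho}(xy)=\Psi_{A\chi,\rho}(yx)=0$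 for all $x\in I_\chi\setminus P_\chi$, $y\in S\setminus I_\chi$; (II) for all $p\in P_\chi$ and $u,v\in S\setminus I_\chi$ we have $up,pv,upv\in P_\chi$ and $\rho(up)=\rho(p)\chi(u)$, $\rho(pv)=\rho(p)\chi(v)$, $\rho(upv)=\rho(p)\chi(uv)$. **Theorem.** Functions $f,g:S\to\mathbb C$ satisfy $$g(xyz_0)=g(x)g(y)-f(x)f(y)\qquad\text{for all } x,y\in S$$ if and only if the pair $(f,g)$ belongs to one of the following families. (1) $f=g=0$. (2) $S\ne S^2z_0$, $f=g$ or $f=-g$, and $g=g_{z_0}$ on $S\setminus S^2z_0$, $g=0$ on $S^2z_0$, where $g_{z_0}:S\setminus S^2z_0\to\mathbb C$ is an arbitrary non-zero function. (3) There are a constant $d\in\mathbb C\setminus\{\pm1\}$ and a multiplicative $\chi$ on $S$ with $\chi(z_0)\ne0$ such that $f=\frac{d\,\chi(z_0)}{1-d^2}\chi$ and $g=\frac{\chi(z_0)}{1-d^2}\chi$. (4) There are a constant $c\in\mathbb C\setminus\{0,\pm i\}$ and two different multiplicative functions $\chi_1,\chi_2$ on $S$ with $\chi_1(z_0)\ne0$,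 $\chi_2(z_0)\ne0$ and $\chi_1(z_0)\chi_1\ne\chi_2(z_0)\chi_2$ such that $$f=-\frac{\chi_1(z_0)\chi_1-\chi_2(z_0)\chi_2}{i(c^{-1}+c)},\qquad g=\frac{c^{-1}\chi_1(z_0)\chi_1+c\,\chi_2(z_0)\chi_2}{c^{-1}+c}.$$ (5) There are constants $q,\gamma\in\mathbb C\setminus\{0\}$ and $\xi\in\mathbb C$ with $\xi^2=1+q^2$, and two different non-zero multiplicative functions $\chi_1,\chi_2$ on $S$ with $\chi_1(z_0)=\frac{q^2-(1+\xi)^2}{2\gamma q}$ and $\chi_2(z_0)=-\frac{q^2-(1-\xi)^2}{2\gamma q}$ such that $$f=\frac{\chi_1+\chi_2}{2\gamma}+\xi\,\frac{\chi_1-\chi_2}{2\gamma},\qquad g=q\,\frac{\chi_1-\chi_2}{2\gamma}.$$ (6) There are constants $\alpha\in\mathbb C$, $q\in\mathbb C\setminus\{\pm\alpha\}$, $\gamma\in\mathbb C\setminus\{0,\pm\alpha\}$ and $\delta\in\mathbb C\setminus\{\pm1\}$ with $\delta^2=1+q^2-\alpha^2$, and two different non-zero multiplicative functions $\chi_1,\chi_2$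 on $S$ with $\chi_1(z_0)=\frac{(1+\delta)^2-(\alpha+q)^2}{2\gamma(1+\delta)}$ and $\chi_2(z_0)=\frac{(1-\delta)^2-(\alpha-q)^2}{2\gamma(1-\delta)}$ such that $$f=\alpha\,\frac{\chi_1+\chi_2}{2\gamma}+q\,\frac{\chi_1-\chi_2}{2\gamma},\qquad g=\frac{\chi_1+\chi_2}{2\gamma}+\delta\,\frac{\chi_1-\chi_2}{2\gamma}.$$ (7) There are a constant $\beta\in\mathbb C\setminus\{0\}$, a non-zero multiplicative $\chi$ on $S$, an additive $A:S\setminus I_\chi\to\mathbb C$ and a function $\rho:P_\chi\to\mathbb C$ with $\chi(z_0)=\frac1\beta$ and $A(z_0)=0$, and a sign $s\in\{1,-1\}$, such that $$f=\frac1\beta\Psi_{A\chi,\rho},\qquad g=\frac1\beta\left(\chi+s\,\Psi_{A\chi,\rho}\right).$$ (8) There are a multiplicative $\chi$ on $S$ with $\chi(z_0)\ne0$, an additive $A:S\setminus I_\chi\to\mathbb C$ and a function $\rho:P_\chi\to\mathbb C$, and a sign $s\in\{1,-1\}$, such that $$f=A(z_0)\chi+\Psi_{A\chi,\rho},\qquad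 g=\left(\chi(z_0)+s\,A(z_0)\right)\chi+s\,\Psi_{A\chi,\rho}.$$ Moreover, if $S$ is a topological semigroup and $f$ is continuous, then $g$ is continuous in each of the cases (1), (2), (4)–(8), and in case (3) if $d\neq0$. -/

import Mathlib

namespace KannappanCosine

variable {S : Type*} [Semigroup S]

/-- The pair `(f, g)` solves the Kannappan-cosine law with fixed element `z₀`. -/
def IsSolution (z₀ : S) (f g : S → ℂ) : Prop :=
  ∀ x y : S, g (x * y * z₀) = g x * g y - f x * f y

/-- `T² = {x y | x, y ∈ T}`. -/
def sqSet (T : Set S) : Set S := {w | ∃ x ∈ T, ∃ y ∈ T, w = x * y}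

/-- `T² z₀ = {x y z₀ | x, y ∈ T}`. -/
def sqMulSet (T : Set S) (z₀ : S) : Set S := {w | ∃ x ∈ T, ∃ y ∈ T, w = x * y * z₀}

/-- An additive function: `A (x y) = A x + A y`. -/
def IsAdditive {T : Type*} [Mul T] (A : T → ℂ) : Prop :=
  ∀ x y : T, A (x * y) = A x + A y

/-- The nullspace `I_χ = {x ∈ S | χ x = 0}` of a multiplicative function. -/
def nullspace (χ : S →ₙ* ℂ) : Set S := {x | χ x = 0}

/-- `S ∖ I_χ`, as a subsemigroup of `S`. -/
def support (χ : S →ₙ* ℂ) : Subsemigroup S where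
  carrier := (nullspace χ)ᶜ
  mul_mem' := by
    intro a b ha hb h
    rcases mul_eq_zero.mp ((map_mul χ a b).symm.trans h) with h | h
    · exact ha h
    · exact hb h

/-- The set `P_χ` of all `p ∈ I_χ ∖ I_χ²` with `u p, p v, u p v ∈ I_χ ∖ I_χ²` for all
`u, v ∈ S ∖ I_χ`. -/
def pSet (χ : S →ₙ* ℂ) : Set S :=
  {p | p ∈ nullspace χ \ sqSet (nullspace χ) ∧
    ∀ u ∈ support χ, ∀ v ∈ support χ,
      u * p ∈ nullspace χ \ sqSet (nullspace χ) ∧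
      p * v ∈ nullspace χ \ sqSet (nullspace χ) ∧
      u * p * v ∈ nullspace χ \ sqSet (nullspace χ)}

open Classical in
/-- The function `Ψ_{Aχ,ρ}`: it is `χ A` on `S ∖ I_χ`, `ρ` on `P_χ`, and `0` on `I_χ ∖ P_χ`. -/
noncomputable def psi (χ : S →ₙ* ℂ) (A : support χ → ℂ) (ρ : pSet χ → ℂ) (x : S) : ℂ :=
  if hx : x ∈ support χ then χ x * A ⟨x, hx⟩
  else if hp : x ∈ pSet χ then ρ ⟨x, hp⟩
  else 0

/-- The requirements on the data `χ`, `A`, `ρ` of a function `Ψ_{Aχ,ρ}`: `χ` is non-zero, `A` is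
additive on `S ∖ I_χ`, `Ψ_{Aχ,ρ}` is not the zero function, and the two compatibility conditions
hold.
The first one: `Ψ (x y) = Ψ (y x) = 0` for `x ∈ I_χ ∖ P_χ` and `y ∈ S ∖ I_χ`.
The second one: for `p ∈ P_χ` and `u, v ∈ S ∖ I_χ` the elements `u p`, `p v`, `u p v` lie in `P_χ`,
and `ρ` takes there the values `ρ(p) χ(u)`, `ρ(p) χ(v)`, `ρ(p) χ(u v)`. -/
structure IsPsiData (χ : S →ₙ* ℂ) (A : support χ → ℂ) (ρ : pSet χ → ℂ) : Prop where
  char_ne_zero : ⇑χ ≠ 0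
  additive : IsAdditive A
  psi_ne_zero : psi χ A ρ ≠ 0
  vanish : ∀ x ∈ nullspace χ \ pSet χ, ∀ y ∈ support χ,
    psi χ A ρ (x * y) = 0 ∧ psi χ A ρ (y * x) = 0
  left : ∀ p : pSet χ, ∀ u ∈ support χ,
    ∃ h : u * p ∈ pSet χ, ρ ⟨u * p, h⟩ = ρ p * χ u
  right : ∀ p : pSet χ, ∀ v ∈ support χ,
    ∃ h : p * v ∈ pSet χ, ρ ⟨p * v, h⟩ = ρ p * χ v
  both : ∀ p : pSet χ, ∀ u ∈ support χ, ∀ v ∈ support χ,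
    ∃ h : u * p * v ∈ pSet χ, ρ ⟨u * p * v, h⟩ = ρ p * χ (u * v)

/-- `f = g = 0`. -/
def Family1 (f g : S → ℂ) : Prop := f = 0 ∧ g = 0

/-- `S ≠ S² z₀`, `f = ± g`, and `g` is an arbitrary non-zero function `h` off `S² z₀` and zero on
`S² z₀`. -/
def Family2 (z₀ : S) (f g : S → ℂ) : Prop :=
  Set.univ ≠ sqMulSet Set.univ z₀ ∧ (f = g ∨ f = -g) ∧
  ∃ h : ↥((sqMulSet Set.univ z₀)ᶜ) → ℂ, h ≠ 0 ∧
    (∀ x (hx : x ∈ (sqMulSet Set.univ z₀)ᶜ), g x = h ⟨x, hx⟩) ∧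
    ∀ x ∈ sqMulSet Set.univ z₀, g x = 0

/-- The third family, with the constant `d` displayed. -/
def Family3 (z₀ : S) (d : ℂ) (f g : S → ℂ) : Prop :=
  d ≠ 1 ∧ d ≠ -1 ∧ ∃ χ : S →ₙ* ℂ, χ z₀ ≠ 0 ∧
    (∀ x, f x = d * χ z₀ / (1 - d ^ 2) * χ x) ∧
    (∀ x, g x = χ z₀ / (1 - d ^ 2) * χ x)

def Family4 (z₀ : S) (f g : S → ℂ) : Prop :=
  ∃ c : ℂ, c ≠ 0 ∧ c ≠ Complex.I ∧ c ≠ -Complex.I ∧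
  ∃ χ₁ χ₂ : S →ₙ* ℂ, χ₁ ≠ χ₂ ∧ χ₁ z₀ ≠ 0 ∧ χ₂ z₀ ≠ 0 ∧
    (fun x => χ₁ z₀ * χ₁ x) ≠ (fun x => χ₂ z₀ * χ₂ x) ∧
    (∀ x, f x = -((χ₁ z₀ * χ₁ x - χ₂ z₀ * χ₂ x) / (Complex.I * (c⁻¹ + c)))) ∧
    (∀ x, g x = (c⁻¹ * χ₁ z₀ * χ₁ x + c * χ₂ z₀ * χ₂ x) / (c⁻¹ + c))

/-- The fifth family; `ξ ^ 2 = 1 + q ^ 2` says that `ξ` is one of the two square roots. -/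
def Family5 (z₀ : S) (f g : S → ℂ) : Prop :=
  ∃ q γ ξ : ℂ, q ≠ 0 ∧ γ ≠ 0 ∧ ξ ^ 2 = 1 + q ^ 2 ∧
  ∃ χ₁ χ₂ : S →ₙ* ℂ, χ₁ ≠ χ₂ ∧ ⇑χ₁ ≠ 0 ∧ ⇑χ₂ ≠ 0 ∧
    χ₁ z₀ = (q ^ 2 - (1 + ξ) ^ 2) / (2 * γ * q) ∧
    χ₂ z₀ = -((q ^ 2 - (1 - ξ) ^ 2) / (2 * γ * q)) ∧
    (∀ x, f x = (χ₁ x + χ₂ x) / (2 * γ) + ξ * ((χ₁ x - χ₂ x) / (2 * γ))) ∧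
    (∀ x, g x = q * ((χ₁ x - χ₂ x) / (2 * γ)))

/-- The sixth family; `δ ^ 2 = 1 + q ^ 2 - α ^ 2` says that `δ` is one of the two square roots. -/
def Family6 (z₀ : S) (f g : S → ℂ) : Prop :=
  ∃ α q γ δ : ℂ, q ≠ α ∧ q ≠ -α ∧ γ ≠ 0 ∧ γ ≠ α ∧ γ ≠ -α ∧ δ ≠ 1 ∧ δ ≠ -1 ∧
    δ ^ 2 = 1 + q ^ 2 - α ^ 2 ∧
  ∃ χ₁ χ₂ : S →ₙ* ℂ, χ₁ ≠ χ₂ ∧ ⇑χ₁ ≠ 0 ∧ ⇑χ₂ ≠ 0 ∧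
    χ₁ z₀ = ((1 + δ) ^ 2 - (α + q) ^ 2) / (2 * γ * (1 + δ)) ∧
    χ₂ z₀ = ((1 - δ) ^ 2 - (α - q) ^ 2) / (2 * γ * (1 - δ)) ∧
    (∀ x, f x = α * ((χ₁ x + χ₂ x) / (2 * γ)) + q * ((χ₁ x - χ₂ x) / (2 * γ))) ∧
    (∀ x, g x = (χ₁ x + χ₂ x) / (2 * γ) + δ * ((χ₁ x - χ₂ x) / (2 * γ)))

/-- The seventh family; `s` is the sign in `±`. -/
def Family7 (z₀ : S) (f g : S → ℂ) : Prop :=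
  ∃ β : ℂ, β ≠ 0 ∧
  ∃ (χ : S →ₙ* ℂ) (A : support χ → ℂ) (ρ : pSet χ → ℂ) (hz : z₀ ∈ support χ) (s : ℂ),
    IsPsiData χ A ρ ∧ χ z₀ = 1 / β ∧ A ⟨z₀, hz⟩ = 0 ∧ (s = 1 ∨ s = -1) ∧
    (∀ x, f x = 1 / β * psi χ A ρ x) ∧
    (∀ x, g x = 1 / β * (χ x + s * psi χ A ρ x))

/-- The eighth family; `s` is the sign in `±`, the same at both places, and `z₀ ∈ S ∖ I_χ` means
`χ z₀ ≠ 0`. -/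
def Family8 (z₀ : S) (f g : S → ℂ) : Prop :=
  ∃ (χ : S →ₙ* ℂ) (A : support χ → ℂ) (ρ : pSet χ → ℂ) (hz : z₀ ∈ support χ) (s : ℂ),
    IsPsiData χ A ρ ∧ (s = 1 ∨ s = -1) ∧
    (∀ x, f x = A ⟨z₀, hz⟩ * χ x + psi χ A ρ x) ∧
    (∀ x, g x = (χ z₀ + s * A ⟨z₀, hz⟩) * χ x + s * psi χ A ρ x)

end KannappanCosine

/-!
That the families consist of solutions is a computation; for the seventh and the eighth it rests on
the sine addition law `Ψ (x y) = Ψ x χ y + χ x Ψ y` of the functions `Ψ = Ψ_{Aχ,ρ}`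
(`IsPsiData.psi_mul`).

Conversely, let `(f, g)` be a solution. If `f` and `g` are linearly dependent, then either `g`
vanishes on `S² z₀`, or the equation becomes `h (x y z₀) = h x h y` for a multiple `h` of `g`, which
`exists_mulHom_of_kannappan` solves. This gives the first three families.

If `f` and `g` are linearly independent, the values `F x = (f x, g x)` span `ℂ²`, and by associativity
of `S` the value `F (x y)` depends bilinearly on `F x` and `F y`. So `ℂ²` becomes an associative algebra
with the invariant non-degenerate symmetric form `B (u, v) = u₂ v₂ - u₁ v₁`, where
`B (F x, F y) = g (x y z₀)`. In dimension two such an algebra is commutative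
(`IsSolution.comm`), and it has a unit because `F z₀ * (0, 1)` is one; hence it is
`ℂ[t] / (t² - l t - κ)` (`IsSolution.exists_quadratic`). If the quadratic has distinct roots, the
two characters of the algebra give multiplicative functions of which `f` and `g` are combinations,
and these pairs form the fourth family. If it has a double root, `f` and `g` are combinations of a
multiplicative function `χ` and a solution of the sine addition law with `χ`, which is some `Ψ_{Aχ,ρ}`
by `exists_psi_eq`; these pairs form the eighth family. The remaining families are special
cases of these.

In the fourth to eighth families, continuity of `g` follows since the multiplicative functions and
the function `Ψ` from which `f` is built are combinations of `f` and one of its right translates.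
-/

namespace KannappanCosine

section

variable {S : Type*} [Semigroup S]

/-! ### The functions `Ψ_{Aχ,ρ}` and the sine addition law -/

theorem psi_of_mem_support {χ : S →ₙ* ℂ} {A : support χ → ℂ} {ρ : pSet χ → ℂ} {x : S}
    (hx : x ∈ support χ) : psi χ A ρ x = χ x * A ⟨x, hx⟩ := by
  simp [psi, hx]

theorem psi_of_mem_pSet {χ : S →ₙ* ℂ} {A : support χ → ℂ} {ρ : pSet χ → ℂ} {x : S}
    (hx : x ∈ pSet χ) : psi χ A ρ x = ρ ⟨x, hx⟩ := by
  have h : x ∉ support χ := fun h => h hx.1.1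
  simp [psi, h, hx]

theorem psi_of_notMem {χ : S →ₙ* ℂ} {A : support χ → ℂ} {ρ : pSet χ → ℂ} {x : S}
    (h : x ∉ support χ) (hx : x ∉ pSet χ) : psi χ A ρ x = 0 := by
  simp [psi, h, hx]

/-- `Ψ_{Aχ,ρ}` satisfies the sine addition law with `χ` as cosine. -/
theorem IsPsiData.psi_mul {χ : S →ₙ* ℂ} {A : support χ → ℂ} {ρ : pSet χ → ℂ}
    (h : IsPsiData χ A ρ) (x y : S) :
    psi χ A ρ (x * y) = psi χ A ρ x * χ y + χ x * psi χ A ρ y := by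
  by_cases hx : x ∈ support χ <;> by_cases hy : y ∈ support χ
  · have hA := h.additive ⟨x, hx⟩ ⟨y, hy⟩
    rw [psi_of_mem_support hx, psi_of_mem_support hy,
      psi_of_mem_support ((support χ).mul_mem hx hy), map_mul]
    rw [MulMemClass.mk_mul_mk] at hA
    rw [hA]
    ring
  · have hy0 : χ y = 0 := not_not.mp hy
    by_cases hp : y ∈ pSet χ
    · obtain ⟨hm, e⟩ := h.left ⟨y, hp⟩ x hx
      rw [psi_of_mem_pSet hm, psi_of_mem_pSet hp, e, hy0]
      ring
    · rw [(h.vanish y ⟨hy0, hp⟩ x hx).2, psi_of_notMem hy hp, hy0]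
      ring
  · have hx0 : χ x = 0 := not_not.mp hx
    by_cases hp : x ∈ pSet χ
    · obtain ⟨hm, e⟩ := h.right ⟨x, hp⟩ y hy
      rw [psi_of_mem_pSet hm, psi_of_mem_pSet hp, e, hx0]
      ring
    · rw [(h.vanish x ⟨hx0, hp⟩ y hy).1, psi_of_notMem hx hp, hx0]
      ring
  · have hx0 : χ x = 0 := not_not.mp hx
    have hy0 : χ y = 0 := not_not.mp hy
    have hm : x * y ∉ support χ := fun hm => hm (by simp [nullspace, hx0])
    have hp : x * y ∉ pSet χ := fun hp => hp.1.2 ⟨x, hx0, y, hy0, rfl⟩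
    rw [psi_of_notMem hm hp, hx0, hy0]
    ring

theorem mul_left_mem_pSet {χ : S →ₙ* ℂ} {p u : S} (hp : p ∈ pSet χ) (hu : u ∈ support χ) :
    u * p ∈ pSet χ := by
  refine ⟨(hp.2 u hu u hu).1, fun u' hu' v hv => ⟨?_, (hp.2 u hu v hv).2.2, ?_⟩⟩
  · rw [← mul_assoc]
    exact (hp.2 _ ((support χ).mul_mem hu' hu) v hv).1
  · rw [← mul_assoc u' u p]
    exact (hp.2 _ ((support χ).mul_mem hu' hu) v hv).2.2

theorem mul_right_mem_pSet {χ : S →ₙ* ℂ} {p v : S} (hp : p ∈ pSet χ) (hv : v ∈ support χ) :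
    p * v ∈ pSet χ := by
  refine ⟨(hp.2 v hv v hv).2.1, fun u hu v' hv' => ⟨?_, ?_, ?_⟩⟩
  · rw [← mul_assoc]
    exact (hp.2 u hu v hv).2.2
  · rw [mul_assoc]
    exact (hp.2 u hu _ ((support χ).mul_mem hv hv')).2.1
  · rw [← mul_assoc u p v, mul_assoc]
    exact (hp.2 u hu _ ((support χ).mul_mem hv hv')).2.2

/-- Conversely, every non-zero solution `ν` of the sine addition law is a function `Ψ_{Aχ,ρ}`, with
`A = ν / χ` on the support of `χ` and `ρ = ν` on `P_χ`. -/
theorem exists_psi_eq {χ : S →ₙ* ℂ} {ν : S → ℂ} (hχ : ⇑χ ≠ 0) (hν : ν ≠ 0)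
    (h : ∀ x y, ν (x * y) = ν x * χ y + χ x * ν y) :
    IsPsiData χ (fun x => ν x / χ x) (fun p => ν p) ∧
      psi χ (fun x => ν x / χ x) (fun p => ν p) = ν := by
  have hsq : ∀ w ∈ sqSet (nullspace χ), ν w = 0 := by
    rintro w ⟨x, hx, y, hy, rfl⟩
    have hx0 : χ x = 0 := hx
    have hy0 : χ y = 0 := hy
    rw [h, hx0, hy0]
    ring
  -- An element of `I_χ ∖ P_χ`, or a multiple of it by elements of the support, lies in `I_χ²`.
  have hv : ∀ x, χ x = 0 → x ∉ pSet χ → ν x = 0 := by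
    intro x hx hp
    by_contra h0
    apply hp
    refine ⟨⟨hx, fun hs => h0 (hsq x hs)⟩, fun u hu v hv => ?_⟩
    have hu0 : χ u ≠ 0 := hu
    have hv0 : χ v ≠ 0 := hv
    refine ⟨⟨?_, fun hs => ?_⟩, ⟨?_, fun hs => ?_⟩, ⟨?_, fun hs => ?_⟩⟩
    · simp [nullspace, hx]
    · have := hsq _ hs
      rw [h, hx] at this
      simp_all
    · simp [nullspace, hx]
    · have := hsq _ hs
      rw [h, hx] at this
      simp_all
    · simp [nullspace, hx]
    · have := hsq _ hs
      rw [h, h, map_mul, hx] at this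
      simp_all
  have hpsi : psi χ (fun x => ν x / χ x) (fun p => ν p) = ν := by
    funext x
    by_cases hx : x ∈ support χ
    · have hx0 : χ x ≠ 0 := hx
      rw [psi_of_mem_support hx]
      field_simp
    · by_cases hp : x ∈ pSet χ
      · rw [psi_of_mem_pSet hp]
      · rw [psi_of_notMem hx hp, hv x (not_not.mp hx) hp]
  have hP : ∀ p : pSet χ, χ p = 0 := fun p => p.2.1.1
  refine ⟨⟨hχ, ?_, hpsi.symm ▸ hν, ?_, ?_, ?_, ?_⟩, hpsi⟩
  · intro x y
    have hx0 : χ x ≠ 0 := x.2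
    have hy0 : χ y ≠ 0 := y.2
    simp only [MulMemClass.coe_mul, h, map_mul]
    field_simp
  · intro x hx y hy
    have hx0 : χ x = 0 := hx.1
    rw [hpsi, h, h, hv x hx.1 hx.2, hx0]
    simp
  · intro p u hu
    refine ⟨mul_left_mem_pSet p.2 hu, ?_⟩
    simp only [h, hP p]
    ring
  · intro p v hv
    refine ⟨mul_right_mem_pSet p.2 hv, ?_⟩
    simp only [h, hP p]
    ring
  · intro p u hu v hv
    refine ⟨mul_right_mem_pSet (mul_left_mem_pSet p.2 hu) hv, ?_⟩
    simp only [h, map_mul, hP p]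
    ring

/-! ### The families consist of solutions -/

theorem Family1.isSolution {z₀ : S} {f g : S → ℂ} (h : Family1 f g) : IsSolution z₀ f g := by
  obtain ⟨rfl, rfl⟩ := h
  intro x y
  simp

theorem Family2.isSolution {z₀ : S} {f g : S → ℂ} (h : Family2 z₀ f g) : IsSolution z₀ f g := by
  obtain ⟨-, hfg, -, -, -, h0⟩ := h
  intro x y
  rw [h0 _ ⟨x, trivial, y, trivial, rfl⟩]
  rcases hfg with rfl | rfl <;> simp

theorem Family3.isSolution {z₀ : S} {d : ℂ} {f g : S → ℂ} (h : Family3 z₀ d f g) :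
    IsSolution z₀ f g := by
  obtain ⟨h1, h2, χ, -, hf, hg⟩ := h
  have hd : 1 - d ^ 2 ≠ 0 := by
    rw [show 1 - d ^ 2 = (1 - d) * (1 + d) by ring]
    exact mul_ne_zero (sub_ne_zero.mpr h1.symm) fun h => h2 (by linear_combination h)
  intro x y
  simp only [hf, hg, map_mul]
  field_simp

/-- Combinations of two multiplicative functions are solutions once the coefficients satisfy
`g₁ g₂ = f₁ f₂` and `gᵢ χᵢ(z₀) = gᵢ² - fᵢ²`. -/
theorem isSolution_of_mulHom_pair {z₀ : S} {f g : S → ℂ} {χ₁ χ₂ : S →ₙ* ℂ} {f₁ f₂ g₁ g₂ : ℂ}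
    (hf : ∀ x, f x = f₁ * χ₁ x + f₂ * χ₂ x) (hg : ∀ x, g x = g₁ * χ₁ x + g₂ * χ₂ x)
    (h₀ : g₁ * g₂ = f₁ * f₂) (h₁ : g₁ * χ₁ z₀ = g₁ ^ 2 - f₁ ^ 2)
    (h₂ : g₂ * χ₂ z₀ = g₂ ^ 2 - f₂ ^ 2) : IsSolution z₀ f g := by
  intro x y
  simp only [hf, hg, map_mul]
  linear_combination χ₁ x * χ₁ y * h₁ + χ₂ x * χ₂ y * h₂ -
    (χ₁ x * χ₂ y + χ₂ x * χ₁ y) * h₀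

theorem inv_add_self_ne_zero {c : ℂ} (h0 : c ≠ 0) (h1 : c ≠ Complex.I) (h2 : c ≠ -Complex.I) :
    c⁻¹ + c ≠ 0 := by
  intro h
  have : (c - Complex.I) * (c + Complex.I) = 0 := by
    field_simp at h
    linear_combination h - Complex.I_sq
  rcases mul_eq_zero.mp this with h | h
  · exact h1 (by linear_combination h)
  · exact h2 (by linear_combination h)

theorem Family4.isSolution {z₀ : S} {f g : S → ℂ} (h : Family4 z₀ f g) : IsSolution z₀ f g := by
  obtain ⟨c, h0, h1, h2, χ₁, χ₂, -, -, -, -, hf, hg⟩ := h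
  have hc := inv_add_self_ne_zero h0 h1 h2
  have hI := Complex.I_ne_zero
  have hcc : c⁻¹ * c = 1 := inv_mul_cancel₀ h0
  have e : ∀ a b : ℂ, -(a / (Complex.I * b)) = Complex.I * a / b := by
    intro a b
    rw [mul_comm Complex.I b, ← div_div, Complex.div_I]
    ring
  refine isSolution_of_mulHom_pair (χ₁ := χ₁) (χ₂ := χ₂)
    (f₁ := Complex.I * χ₁ z₀ / (c⁻¹ + c)) (f₂ := -(Complex.I * χ₂ z₀ / (c⁻¹ + c)))
    (g₁ := c⁻¹ * χ₁ z₀ / (c⁻¹ + c)) (g₂ := c * χ₂ z₀ / (c⁻¹ + c))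
    (fun x => by rw [hf, e]; ring) (fun x => by rw [hg]; ring) ?_ ?_ ?_
  · generalize c⁻¹ + c = k at *
    field_simp
    linear_combination χ₁ z₀ * χ₂ z₀ * Complex.I_sq
  · have : χ₁ z₀ ^ 2 * (c⁻¹ * (c⁻¹ + c)) =
        χ₁ z₀ ^ 2 * (c⁻¹ ^ 2 - Complex.I ^ 2) := by
      rw [Complex.I_sq]; linear_combination χ₁ z₀ ^ 2 * hcc
    generalize c⁻¹ + c = k at *
    generalize c⁻¹ = b at *
    field_simp
    linear_combination this
  · have : χ₂ z₀ ^ 2 * (c * (c⁻¹ + c)) =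
        χ₂ z₀ ^ 2 * (c ^ 2 - Complex.I ^ 2) := by
      rw [Complex.I_sq]; linear_combination χ₂ z₀ ^ 2 * hcc
    generalize c⁻¹ + c = k at *
    field_simp
    linear_combination this

theorem Family5.isSolution {z₀ : S} {f g : S → ℂ} (h : Family5 z₀ f g) : IsSolution z₀ f g := by
  obtain ⟨q, γ, ξ, hq, hγ, hξ, χ₁, χ₂, -, -, -, h1, h2, hf, hg⟩ := h
  refine isSolution_of_mulHom_pair (χ₁ := χ₁) (χ₂ := χ₂)
    (f₁ := (1 + ξ) / (2 * γ)) (f₂ := (1 - ξ) / (2 * γ)) (g₁ := q / (2 * γ)) (g₂ := -q / (2 * γ))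
    (fun x => by rw [hf]; ring) (fun x => by rw [hg]; ring) ?_ ?_ ?_
  · field_simp
    linear_combination hξ
  · rw [h1]
    field_simp
  · rw [h2]
    field_simp

theorem Family6.isSolution {z₀ : S} {f g : S → ℂ} (h : Family6 z₀ f g) : IsSolution z₀ f g := by
  obtain ⟨α, q, γ, δ, -, -, hγ, -, -, hδ1, hδ2, hδ, χ₁, χ₂, -, -, -, h1, h2, hf, hg⟩ := h
  have hp : 1 + δ ≠ 0 := fun h => hδ2 (by linear_combination h)
  have hm : 1 - δ ≠ 0 := sub_ne_zero.mpr hδ1.symm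
  refine isSolution_of_mulHom_pair (χ₁ := χ₁) (χ₂ := χ₂)
    (f₁ := (α + q) / (2 * γ)) (f₂ := (α - q) / (2 * γ))
    (g₁ := (1 + δ) / (2 * γ)) (g₂ := (1 - δ) / (2 * γ))
    (fun x => by rw [hf]; ring) (fun x => by rw [hg]; ring) ?_ ?_ ?_
  · field_simp
    linear_combination -hδ
  · rw [h1]
    field_simp
  · rw [h2]
    field_simp

theorem Family8.isSolution {z₀ : S} {f g : S → ℂ} (h : Family8 z₀ f g) : IsSolution z₀ f g := by
  obtain ⟨χ, A, ρ, hz, s, hd, hs, hf, hg⟩ := h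
  have hs2 : s ^ 2 = 1 := by rcases hs with rfl | rfl <;> norm_num
  have ha := psi_of_mem_support (A := A) (ρ := ρ) hz
  intro x y
  simp only [hf, hg, map_mul, hd.psi_mul, ha]
  generalize A ⟨z₀, hz⟩ = a
  generalize psi χ A ρ x = u
  generalize psi χ A ρ y = v
  linear_combination -(a * χ x + u) * (a * χ y + v) * hs2

/-- The seventh family is the part of the eighth where `A(z₀) = 0`, up to scaling `A` and `ρ` by
`χ(z₀)`. -/
theorem Family7.isSolution {z₀ : S} {f g : S → ℂ} (h : Family7 z₀ f g) : IsSolution z₀ f g := by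
  obtain ⟨β, hβ, χ, A, ρ, hz, s, hd, hχ, hA, hs, hf, hg⟩ := h
  have hs2 : s ^ 2 = 1 := by rcases hs with rfl | rfl <;> norm_num
  have ha := psi_of_mem_support (A := A) (ρ := ρ) hz
  rw [hA, mul_zero] at ha
  intro x y
  simp only [hf, hg, map_mul, hd.psi_mul, ha, hχ]
  generalize psi χ A ρ x = u
  generalize psi χ A ρ y = v
  linear_combination -(1 / β) ^ 2 * u * v * hs2

/-! ### Continuity -/

section Continuity

variable [TopologicalSpace S]

theorem Family2.continuous {z₀ : S} {f g : S → ℂ} (h : Family2 z₀ f g) (hc : Continuous f) :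
    Continuous g := by
  rcases h.2.1 with h | h
  · exact h ▸ hc
  · rw [show g = -f by rw [h, neg_neg]]
    exact hc.neg

theorem Family3.continuous {z₀ : S} {d : ℂ} (hd : d ≠ 0) {f g : S → ℂ} (h : Family3 z₀ d f g)
    (hc : Continuous f) : Continuous g := by
  obtain ⟨-, -, χ, -, hf, hg⟩ := h
  have : g = fun x => d⁻¹ * f x := by
    funext x
    rw [hf, hg]
    field_simp
  rw [this]
  fun_prop

variable [ContinuousMul S]

/-- If a combination of two different multiplicative functions with non-zero coefficients is
continuous, so is each of them: subtracting `χ₂(y)` times the combination from its translate by `y`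
isolates `χ₁`. -/
theorem continuous_of_continuous_comb {χ₁ χ₂ : S →ₙ* ℂ} (hne : χ₁ ≠ χ₂) {f : S → ℂ} {a b : ℂ}
    (ha : a ≠ 0) (hb : b ≠ 0) (hf : ∀ x, f x = a * χ₁ x + b * χ₂ x) (hc : Continuous f) :
    Continuous χ₁ ∧ Continuous χ₂ := by
  obtain ⟨y, hy⟩ := DFunLike.ne_iff.mp hne
  have hy' : χ₁ y - χ₂ y ≠ 0 := sub_ne_zero.mpr hy
  have ht : Continuous fun x => f (x * y) := hc.comp (continuous_mul_const y)
  constructor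
  · have : ⇑χ₁ = fun x => (f (x * y) - χ₂ y * f x) / (a * (χ₁ y - χ₂ y)) := by
      funext x
      simp only [hf, map_mul]
      field_simp
      ring
    rw [this]
    fun_prop
  · have : ⇑χ₂ = fun x => (χ₁ y * f x - f (x * y)) / (b * (χ₁ y - χ₂ y)) := by
      funext x
      simp only [hf, map_mul]
      field_simp
      ring
    rw [this]
    fun_prop

/-- If `a χ + Ψ_{Aχ,ρ}` is continuous, so are `χ` and `Ψ_{Aχ,ρ}`. -/
theorem IsPsiData.continuous {χ : S →ₙ* ℂ} {A : support χ → ℂ} {ρ : pSet χ → ℂ}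
    (h : IsPsiData χ A ρ) {f : S → ℂ} {a : ℂ} (hf : ∀ x, f x = a * χ x + psi χ A ρ x)
    (hc : Continuous f) : Continuous χ ∧ Continuous (psi χ A ρ) := by
  obtain ⟨y, hy⟩ := Function.ne_iff.mp h.psi_ne_zero
  have hy' : psi χ A ρ y ≠ 0 := hy
  have ht : Continuous fun x => f (x * y) := hc.comp (continuous_mul_const y)
  have hχ : Continuous χ := by
    have : ⇑χ = fun x => (f (x * y) - f x * χ y) / psi χ A ρ y := by
      funext x
      simp only [hf, map_mul, h.psi_mul]
      field_simp
      ring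
    rw [this]
    fun_prop
  refine ⟨hχ, ?_⟩
  have : psi χ A ρ = fun x => f x - a * χ x := by
    funext x
    rw [hf]
    ring
  rw [this]
  fun_prop

theorem Family4.continuous {z₀ : S} {f g : S → ℂ} (h : Family4 z₀ f g) (hc : Continuous f) :
    Continuous g := by
  obtain ⟨c, h0, h1, h2, χ₁, χ₂, hne, hz1, hz2, -, hf, hg⟩ := h
  have hk : Complex.I * (c⁻¹ + c) ≠ 0 :=
    mul_ne_zero Complex.I_ne_zero (inv_add_self_ne_zero h0 h1 h2)
  obtain ⟨hc1, hc2⟩ := continuous_of_continuous_comb hne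
    (a := -(χ₁ z₀ / (Complex.I * (c⁻¹ + c)))) (b := χ₂ z₀ / (Complex.I * (c⁻¹ + c)))
    (neg_ne_zero.mpr (div_ne_zero hz1 hk)) (div_ne_zero hz2 hk)
    (fun x => by rw [hf]; ring) hc
  rw [funext hg]
  fun_prop

theorem Family5.continuous {z₀ : S} {f g : S → ℂ} (h : Family5 z₀ f g) (hc : Continuous f) :
    Continuous g := by
  obtain ⟨q, γ, ξ, hq, hγ, hξ, χ₁, χ₂, hne, -, -, -, -, hf, hg⟩ := h
  -- The coefficients of `f` have product a multiple of `1 - ξ² = -q²`.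
  have hξ' : (1 + ξ) * (1 - ξ) ≠ 0 := by
    rw [show (1 + ξ) * (1 - ξ) = -q ^ 2 by linear_combination -hξ]
    exact neg_ne_zero.mpr (pow_ne_zero 2 hq)
  have h2γ : 2 * γ ≠ 0 := mul_ne_zero two_ne_zero hγ
  obtain ⟨hc1, hc2⟩ := continuous_of_continuous_comb hne
    (a := (1 + ξ) / (2 * γ)) (b := (1 - ξ) / (2 * γ))
    (div_ne_zero (left_ne_zero_of_mul hξ') h2γ) (div_ne_zero (right_ne_zero_of_mul hξ') h2γ)
    (fun x => by rw [hf]; ring) hc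
  rw [funext hg]
  fun_prop

theorem Family6.continuous {z₀ : S} {f g : S → ℂ} (h : Family6 z₀ f g) (hc : Continuous f) :
    Continuous g := by
  obtain ⟨α, q, γ, δ, hq1, hq2, hγ, -, -, -, -, -, χ₁, χ₂, hne, -, -, -, -, hf, hg⟩ := h
  have h2γ : 2 * γ ≠ 0 := mul_ne_zero two_ne_zero hγ
  obtain ⟨hc1, hc2⟩ := continuous_of_continuous_comb hne
    (a := (α + q) / (2 * γ)) (b := (α - q) / (2 * γ))
    (div_ne_zero (fun h => hq2 (by linear_combination h)) h2γ)
    (div_ne_zero (sub_ne_zero.mpr hq1.symm) h2γ)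
    (fun x => by rw [hf]; ring) hc
  rw [funext hg]
  fun_prop

theorem Family7.continuous {z₀ : S} {f g : S → ℂ} (h : Family7 z₀ f g) (hc : Continuous f) :
    Continuous g := by
  obtain ⟨β, hβ, χ, A, ρ, hz, s, hd, -, -, -, hf, hg⟩ := h
  have hc' : Continuous fun x => β * f x := by fun_prop
  obtain ⟨h1, h2⟩ := hd.continuous (a := 0) (fun x => by rw [hf]; field_simp; ring) hc'
  rw [funext hg]
  fun_prop

theorem Family8.continuous {z₀ : S} {f g : S → ℂ} (h : Family8 z₀ f g) (hc : Continuous f) :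
    Continuous g := by
  obtain ⟨χ, A, ρ, hz, s, hd, -, hf, hg⟩ := h
  obtain ⟨h1, h2⟩ := hd.continuous hf hc
  rw [funext hg]
  fun_prop

end Continuity

/-! ### Linearly dependent solutions -/

/-- The solutions of `h (x y z₀) = h x * h y` are the functions `χ(z₀) χ`. Evaluating at
`x z₀ y z₀` in two ways shows that translation by `z₀` multiplies `h` by a constant `κ`, and then
`χ = h / κ` is multiplicative with `χ(z₀) = κ`. -/
theorem exists_mulHom_of_kannappan {z₀ : S} {h : S → ℂ} (h0 : h ≠ 0)
    (hh : ∀ x y, h (x * y * z₀) = h x * h y) :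
    ∃ χ : S →ₙ* ℂ, χ z₀ ≠ 0 ∧ ∀ x, h x = χ z₀ * χ x := by
  obtain ⟨w, hw⟩ := Function.ne_iff.mp h0
  replace hw : h w ≠ 0 := hw
  have e : ∀ x y, h (x * z₀) * h y = h x * h (z₀ * y) := by
    intro x y
    rw [← hh, ← hh, ← mul_assoc x]
  obtain ⟨κ, hκ⟩ : ∃ κ, ∀ x, h (x * z₀) = κ * h x :=
    ⟨h (z₀ * w) / h w, fun x => by field_simp; linear_combination e x w⟩
  have hκ0 : κ ≠ 0 := by
    rintro rfl
    have := hh w w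
    rw [hκ, zero_mul] at this
    exact mul_ne_zero hw hw this.symm
  have hm : ∀ x y, κ * h (x * y) = h x * h y := fun x y => by rw [← hκ, hh]
  have hz : h z₀ = κ ^ 2 := by
    have h1 := hm w z₀
    rw [hκ] at h1
    exact mul_left_cancel₀ hw (by linear_combination -h1)
  refine ⟨⟨fun x => h x / κ, fun x y => ?_⟩, ?_, fun x => ?_⟩
  · have := hm x y
    field_simp
    linear_combination this
  · change h z₀ / κ ≠ 0
    rw [hz]
    exact div_ne_zero (pow_ne_zero 2 hκ0) hκ0
  · change h x = h z₀ / κ * (h x / κ)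
    rw [hz]
    field_simp

theorem IsSolution.family_of_not_linearIndependent {z₀ : S} {f g : S → ℂ}
    (h : IsSolution z₀ f g) (hi : ¬ LinearIndependent ℂ ![f, g]) :
    Family1 f g ∨ Family2 z₀ f g ∨ ∃ d, Family3 z₀ d f g := by
  by_cases hg0 : g = 0
  · left
    refine ⟨funext fun x => ?_, hg0⟩
    have := h x x
    simp only [hg0, Pi.zero_apply] at this
    exact mul_self_eq_zero.mp (by simpa using this)
  right
  obtain ⟨d, hd⟩ : ∃ d : ℂ, ∀ x, f x = d * g x := by
    rw [LinearIndependent.pair_iff] at hi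
    push Not at hi
    obtain ⟨s, t, e, hst⟩ := hi
    have e' : ∀ x, s * f x + t * g x = 0 := fun x => congrFun e x
    have hs : s ≠ 0 := by
      rintro rfl
      refine hg0 (funext fun x => ?_)
      have := e' x
      rw [zero_mul, zero_add] at this
      exact (mul_eq_zero.mp this).resolve_left (hst rfl)
    refine ⟨-t / s, fun x => ?_⟩
    field_simp
    linear_combination e' x
  by_cases hd1 : d = 1 ∨ d = -1
  · left
    have hzero : ∀ w ∈ sqMulSet Set.univ z₀, g w = 0 := by
      rintro w ⟨x, -, y, -, rfl⟩
      rw [h, hd, hd]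
      rcases hd1 with rfl | rfl <;> ring
    obtain ⟨w, hw⟩ := Function.ne_iff.mp hg0
    have hw' : w ∈ (sqMulSet Set.univ z₀)ᶜ := fun hm => hw (hzero w hm)
    refine ⟨fun hu => hw' (hu ▸ Set.mem_univ w), ?_, fun x => g x, ?_, fun x hx => rfl, hzero⟩
    · refine hd1.imp ?_ ?_ <;> rintro rfl <;> funext x <;> simp [hd]
    · exact Function.ne_iff.mpr ⟨⟨w, hw'⟩, hw⟩
  · right
    push Not at hd1
    have hk : 1 - d ^ 2 ≠ 0 := by
      rw [show 1 - d ^ 2 = (1 - d) * (1 + d) by ring]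
      exact mul_ne_zero (sub_ne_zero.mpr hd1.1.symm) fun h => hd1.2 (by linear_combination h)
    obtain ⟨χ, hz, hχ⟩ := exists_mulHom_of_kannappan (z₀ := z₀) (h := fun x => (1 - d ^ 2) * g x)
      (fun e => hg0 (funext fun x => (mul_eq_zero.mp (congrFun e x)).resolve_left hk))
      (fun x y => by simp only [h x y, hd]; ring)
    have hgx : ∀ x, g x = χ z₀ / (1 - d ^ 2) * χ x := fun x => by
      have := hχ x
      field_simp
      linear_combination this
    refine ⟨d, hd1.1, hd1.2, χ, hz, fun x => ?_, hgx⟩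
    rw [hd, hgx]
    ring

/-! ### Pairs of linearly independent functions -/

section Pairs

variable {X : Type*} {f g : X → ℂ}

theorem coeff_eq_zero (hi : LinearIndependent ℂ ![f, g]) {s t : ℂ}
    (h : ∀ x, s * f x + t * g x = 0) : s = 0 ∧ t = 0 :=
  LinearIndependent.pair_iff.mp hi s t (funext h)

theorem bilin_coeff_eq_zero (hi : LinearIndependent ℂ ![f, g]) {p q q' r : ℂ}
    (h : ∀ x y, p * (f x * f y) + q * (f x * g y) + q' * (g x * f y) + r * (g x * g y) = 0) :
    p = 0 ∧ q = 0 ∧ q' = 0 ∧ r = 0 := by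
  have h' : ∀ y, p * f y + q * g y = 0 ∧ q' * f y + r * g y = 0 := fun y =>
    coeff_eq_zero hi fun x => by linear_combination h x y
  have h1 := coeff_eq_zero hi fun y => (h' y).1
  have h2 := coeff_eq_zero hi fun y => (h' y).2
  exact ⟨h1.1, h1.2, h2.1, h2.2⟩

theorem exists_det_ne_zero (hi : LinearIndependent ℂ ![f, g]) :
    ∃ x₁ x₂, f x₁ * g x₂ - f x₂ * g x₁ ≠ 0 := by
  by_contra! h
  have h1 : ∀ x, f x = 0 := fun x =>
    (neg_eq_zero.mp (coeff_eq_zero hi (s := g x) (t := -f x)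
      fun y => by linear_combination h y x).2)
  exact one_ne_zero (coeff_eq_zero hi (s := 1) (t := 0) fun x => by simp [h1]).1

/-- A symmetric function of two variables that is a combination of `f` and `g` in the first
variable is a symmetric bilinear expression in the values of `(f, g)`. -/
theorem exists_bilin (hi : LinearIndependent ℂ ![f, g]) {β : X → X → ℂ}
    (hs : ∀ x y, β x y = β y x) (hl : ∀ y, ∃ a b : ℂ, ∀ x, β x y = a * f x + b * g x) :
    ∃ p q r : ℂ, ∀ x y,
      β x y = p * (f x * f y) + q * (f x * g y + g x * f y) + r * (g x * g y) := by
  obtain ⟨x₁, x₂, hΔ⟩ := exists_det_ne_zero hi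
  choose a b hab using hl
  generalize hD : f x₁ * g x₂ - f x₂ * g x₁ = D at hΔ
  have ha : ∃ s t : ℂ, ∀ y, a y = s * f y + t * g y := by
    refine ⟨(a x₁ * g x₂ - a x₂ * g x₁) / D, (b x₁ * g x₂ - b x₂ * g x₁) / D, fun y => ?_⟩
    have h1 := hs x₁ y
    have h2 := hs x₂ y
    simp only [hab] at h1 h2
    field_simp
    rw [← hD]
    linear_combination g x₂ * h1 - g x₁ * h2
  have hb : ∃ s t : ℂ, ∀ y, b y = s * f y + t * g y := by
    refine ⟨(a x₂ * f x₁ - a x₁ * f x₂) / D, (b x₂ * f x₁ - b x₁ * f x₂) / D, fun y => ?_⟩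
    have h1 := hs x₁ y
    have h2 := hs x₂ y
    simp only [hab] at h1 h2
    field_simp
    rw [← hD]
    linear_combination -f x₂ * h1 + f x₁ * h2
  obtain ⟨p, q, ha⟩ := ha
  obtain ⟨q', r, hb⟩ := hb
  have hq : q - q' = 0 := (bilin_coeff_eq_zero hi (p := 0) (q := q - q') (q' := q' - q) (r := 0)
    fun x y => by
      have := hs x y
      simp only [hab, ha, hb] at this
      linear_combination this).2.1
  refine ⟨p, q, r, fun x y => ?_⟩
  rw [hab, ha, hb]
  linear_combination -(g x * f y) * hq

/-- The matrix expressing two independent functions in terms of two others is invertible. -/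
theorem comb_det_ne_zero (hi : LinearIndependent ℂ ![f, g]) {φ ψ : X → ℂ} {a b a' b' : ℂ}
    (hf : ∀ x, f x = a * φ x + b * ψ x) (hg : ∀ x, g x = a' * φ x + b' * ψ x) :
    a * b' - b * a' ≠ 0 := by
  intro h0
  have h2 := coeff_eq_zero hi (s := b') (t := -b) fun x => by
    rw [hf, hg]
    linear_combination φ x * h0
  have h3 := coeff_eq_zero hi (s := -a') (t := a) fun x => by
    rw [hf, hg]
    linear_combination ψ x * h0
  refine one_ne_zero (coeff_eq_zero hi (s := 1) (t := 0) fun x => ?_).1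
  rw [hf, h3.2, neg_eq_zero.mp h2.2]
  ring

theorem linearIndependent_of_comb (hi : LinearIndependent ℂ ![f, g]) {φ ψ : X → ℂ}
    {a b a' b' : ℂ} (hf : ∀ x, f x = a * φ x + b * ψ x)
    (hg : ∀ x, g x = a' * φ x + b' * ψ x) : LinearIndependent ℂ ![φ, ψ] := by
  have hdet := comb_det_ne_zero hi hf hg
  rw [LinearIndependent.pair_iff]
  intro s t hst
  have e : ∀ x, s * φ x + t * ψ x = 0 := fun x => congrFun hst x
  have h1 := coeff_eq_zero hi (s := s * b' - t * a') (t := -(s * b - t * a)) fun x => by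
    rw [hf, hg]
    linear_combination (a * b' - b * a') * e x
  constructor
  · refine (mul_eq_zero.mp (?_ : s * (a * b' - b * a') = 0)).resolve_right hdet
    linear_combination a * h1.1 + a' * h1.2
  · refine (mul_eq_zero.mp (?_ : t * (a * b' - b * a') = 0)).resolve_right hdet
    linear_combination b * h1.1 + b' * h1.2

end Pairs

/-! ### Linearly independent solutions: the algebra of values -/

section Independent

variable {f g : S → ℂ}

/-- The right translates of `f` and `g` are combinations of `f` and `g`, because
`g (x y w z₀) = g (x y) g w - f (x y) f w = g x g (y w) - f x f (y w)`, an equation that can be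
solved for `f (x y)` and `g (x y)` with two values of `w`. -/
theorem IsSolution.exists_translate {z₀ : S} (h : IsSolution z₀ f g)
    (hi : LinearIndependent ℂ ![f, g]) (y : S) :
    (∃ a b : ℂ, ∀ x, f (x * y) = a * f x + b * g x) ∧
      ∃ a b : ℂ, ∀ x, g (x * y) = a * f x + b * g x := by
  obtain ⟨x₁, x₂, hΔ⟩ := exists_det_ne_zero hi
  have e : ∀ x w, g (x * y) * g w - f (x * y) * f w = g x * g (y * w) - f x * f (y * w) := by
    intro x w
    rw [← h, ← h, mul_assoc x]
  generalize hD : f x₁ * g x₂ - f x₂ * g x₁ = D at hΔ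
  constructor
  · refine ⟨(f (y * x₁) * g x₂ - f (y * x₂) * g x₁) / D,
      -(g (y * x₁) * g x₂ - g (y * x₂) * g x₁) / D, fun x => ?_⟩
    field_simp
    rw [← hD]
    linear_combination -g x₂ * e x x₁ + g x₁ * e x x₂
  · refine ⟨(f (y * x₁) * f x₂ - f (y * x₂) * f x₁) / D,
      -(g (y * x₁) * f x₂ - g (y * x₂) * f x₁) / D, fun x => ?_⟩
    field_simp
    rw [← hD]
    linear_combination -f x₂ * e x x₁ + f x₁ * e x x₂

/-- The values of `f` and `g` at a product do not depend on the order of the factors. The function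
`(x, y, w) ↦ g (x y w z₀)` is invariant under cyclic permutations and trilinear in the values
of `(f, g)`; its antisymmetrisation is an alternating trilinear form on a plane, hence zero. -/
theorem IsSolution.comm {z₀ : S} (h : IsSolution z₀ f g)
    (hi : LinearIndependent ℂ ![f, g]) (x y : S) :
    f (x * y) = f (y * x) ∧ g (x * y) = g (y * x) := by
  obtain ⟨x₁, x₂, hΔ⟩ := exists_det_ne_zero hi
  obtain ⟨T, hT⟩ : ∃ T : S → S → S → ℂ, ∀ x y w, T x y w = g (x * y * w * z₀) :=
    ⟨_, fun _ _ _ => rfl⟩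
  have cyc : ∀ x y w, T x y w = T y w x := by
    intro x y w
    rw [hT, hT, mul_assoc x y w, h, h]
    ring
  have lin : ∀ x, ∃ s t : ℂ, ∀ y w, T x y w = s * T x₁ y w + t * T x₂ y w := by
    intro x
    refine ⟨(f x * g x₂ - g x * f x₂) / (f x₁ * g x₂ - f x₂ * g x₁),
      (g x * f x₁ - f x * g x₁) / (f x₁ * g x₂ - f x₂ * g x₁), fun y w => ?_⟩
    rw [hT, hT, hT, mul_assoc x, mul_assoc x₁, mul_assoc x₂, h, h, h]
    generalize hD : f x₁ * g x₂ - f x₂ * g x₁ = D at hΔ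
    field_simp
    rw [← hD]
    ring
  have hD : ∀ w, T x₁ x₂ w = T x₂ x₁ w := by
    intro w
    obtain ⟨s, t, hst⟩ := lin w
    rw [← cyc w x₁ x₂, ← cyc w x₂ x₁, hst, hst, cyc x₁ x₁ x₂, ← cyc x₂ x₂ x₁]
  have hS : ∀ x y w, T x y w = T y x w := by
    intro x y w
    obtain ⟨s, t, hx⟩ := lin x
    obtain ⟨s', t', hy⟩ := lin y
    -- The same expansion in the second argument, by cyclic invariance.
    have hy2 : ∀ x w, T x y w = s' * T x x₁ w + t' * T x x₂ w := fun x w => by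
      rw [cyc x y w, hy, ← cyc x x₁ w, ← cyc x x₂ w]
    have hx2 : ∀ y w, T y x w = s * T y x₁ w + t * T y x₂ w := fun y w => by
      rw [cyc y x w, hx, ← cyc y x₁ w, ← cyc y x₂ w]
    rw [hx, hy2, hy2, hy, hx2, hx2]
    linear_combination (s * t' - t * s') * hD w
  have h0 := coeff_eq_zero hi (s := -(f (x * y) - f (y * x))) (t := g (x * y) - g (y * x))
    fun w => by
      have := hS x y w
      rw [hT, hT, h, h] at this
      linear_combination this
  exact ⟨sub_eq_zero.mp (neg_eq_zero.mp h0.1), sub_eq_zero.mp h0.2⟩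

/-- The values of `(f, g)` at a product are given by a commutative multiplication on `ℂ²`. Its
structure constants are those of a symmetric trilinear form, because the bilinear form
`g x g y - f x f y` is invariant. -/
theorem IsSolution.exists_structure_constants {z₀ : S} (h : IsSolution z₀ f g)
    (hi : LinearIndependent ℂ ![f, g]) :
    ∃ p q r s : ℂ,
      (∀ x y, f (x * y) = -(p * (f x * f y) + q * (f x * g y + g x * f y) + r * (g x * g y))) ∧
      ∀ x y, g (x * y) = q * (f x * f y) + r * (f x * g y + g x * f y) + s * (g x * g y) := by
  obtain ⟨p₁, q₁, r₁, hf⟩ := exists_bilin hi (β := fun x y => f (x * y))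
    (fun x y => (h.comm hi x y).1) fun y => (h.exists_translate hi y).1
  obtain ⟨p₂, q₂, r₂, hg⟩ := exists_bilin hi (β := fun x y => g (x * y))
    (fun x y => (h.comm hi x y).2) fun y => (h.exists_translate hi y).2
  have e : ∀ x y w, g (x * y) * g w - f (x * y) * f w = g x * g (y * w) - f x * f (y * w) := by
    intro x y w
    rw [← h, ← h, mul_assoc x]
  simp only [hf, hg] at e
  have hc := fun y w => (coeff_eq_zero hi
    (s := (p₂ + q₁) * f y * g w + (q₂ + r₁) * g y * g w)
    (t := -(p₂ + q₁) * f y * f w - (q₂ + r₁) * g y * f w)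
    fun x => by linear_combination e x y w).1
  have hk := bilin_coeff_eq_zero hi (p := 0) (q := p₂ + q₁) (q' := 0) (r := q₂ + r₁)
    fun x y => by linear_combination hc x y
  refine ⟨-p₁, p₂, q₂, r₂, fun x y => ?_, hg⟩
  rw [hf]
  linear_combination (f x * g y + g x * f y) * hk.2.1 + g x * g y * hk.2.2.2

/-- The multiplication on `ℂ²` has a unit `e`, namely the product of `(f z₀, g z₀)` and `(0, 1)`.
In coordinates `(f, g) = c e + k t`, where `t` is a vector independent of `e` with
`t² = κ e + l t`, it is the multiplication of `ℂ[t] / (t² - l t - κ)`. -/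
theorem IsSolution.exists_quadratic {z₀ : S} (h : IsSolution z₀ f g)
    (hi : LinearIndependent ℂ ![f, g]) :
    ∃ (c k : S → ℂ) (κ l : ℂ),
      (∀ x y, c (x * y) = c x * c y + κ * (k x * k y)) ∧
      (∀ x y, k (x * y) = c x * k y + k x * c y + l * (k x * k y)) ∧
      (∃ a b : ℂ, ∀ x, f x = a * c x + b * k x) ∧ ∃ a b : ℂ, ∀ x, g x = a * c x + b * k x := by
  obtain ⟨p, q, r, s, hf, hg⟩ := h.exists_structure_constants hi
  -- The unit is `e = (-m, n)`.
  obtain ⟨m, hm⟩ : ∃ m, m = q * f z₀ + r * g z₀ := ⟨_, rfl⟩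
  obtain ⟨n, hn⟩ : ∃ n, n = r * f z₀ + s * g z₀ := ⟨_, rfl⟩
  obtain ⟨h1, h2, -, h3⟩ := bilin_coeff_eq_zero hi
    (p := 1 - m * p + n * q) (q := -m * q + n * r) (q' := -m * q + n * r)
    (r := -1 - m * r + n * s) fun x y => by
      have := h x y
      rw [hg (x * y) z₀, hf x y, hg x y] at this
      rw [hm, hn]
      linear_combination this
  -- A vector `t = (u, v)` such that `(e, t)` has determinant `1`.
  obtain ⟨u, v, huv⟩ : ∃ u v : ℂ, -m * v - n * u = 1 := by
    by_cases hm0 : m = 0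
    · have hn0 : n ≠ 0 := by
        rintro rfl
        rw [hm0] at h1
        simp at h1
      exact ⟨-1 / n, 0, by field_simp; ring⟩
    · exact ⟨0, -1 / m, by field_simp; ring⟩
  obtain ⟨a, ha⟩ : ∃ a, a = -(p * u ^ 2 + 2 * q * u * v + r * v ^ 2) := ⟨_, rfl⟩
  obtain ⟨b, hb⟩ : ∃ b, b = q * u ^ 2 + 2 * r * u * v + s * v ^ 2 := ⟨_, rfl⟩
  obtain ⟨c, hc⟩ : ∃ c : S → ℂ, ∀ x, c x = v * f x - u * g x := ⟨_, fun _ => rfl⟩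
  obtain ⟨k, hk⟩ : ∃ k : S → ℂ, ∀ x, k x = -m * g x - n * f x := ⟨_, fun _ => rfl⟩
  have hfc : ∀ x, f x = -m * c x + u * k x := fun x => by
    rw [hc, hk]; linear_combination -f x * huv
  have hgc : ∀ x, g x = n * c x + v * k x := fun x => by
    rw [hc, hk]; linear_combination -g x * huv
  have hf' : ∀ x y, f (x * y) =
      -m * (c x * c y) + u * (c x * k y + k x * c y) + a * (k x * k y) := fun x y => by
    rw [hf, hfc x, hfc y, hgc x, hgc y, ha]
    linear_combination (m * h1 - n * h2) * (c x * c y) -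
      (u * h1 + v * h2) * (c x * k y + k x * c y)
  have hg' : ∀ x y, g (x * y) =
      n * (c x * c y) + v * (c x * k y + k x * c y) + b * (k x * k y) := fun x y => by
    rw [hg, hfc x, hfc y, hgc x, hgc y, hb]
    linear_combination (n * h3 - m * h2) * (c x * c y) +
      (u * h2 + v * h3) * (c x * k y + k x * c y)
  refine ⟨c, k, v * a - u * b, -m * b - n * a, fun x y => ?_, fun x y => ?_,
    ⟨_, _, hfc⟩, ⟨_, _, hgc⟩⟩
  · rw [hc (x * y), hf', hg']
    linear_combination c x * c y * huv
  · rw [hk (x * y), hf', hg']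
    linear_combination (c x * k y + k x * c y) * huv

/-! ### Linearly independent solutions: the two cases -/

/-- Combinations of two multiplicative functions belong to the fourth family, with
`c = -i f₁ / g₁` in terms of the coefficients of `χ₁` in `f` and `g`. -/
theorem IsSolution.family4 {z₀ : S} (h : IsSolution z₀ f g)
    (hi : LinearIndependent ℂ ![f, g]) {χ₁ χ₂ : S →ₙ* ℂ} {f₁ f₂ g₁ g₂ : ℂ}
    (hf : ∀ x, f x = f₁ * χ₁ x + f₂ * χ₂ x) (hg : ∀ x, g x = g₁ * χ₁ x + g₂ * χ₂ x) :
    Family4 z₀ f g := by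
  have hχ := linearIndependent_of_comb hi hf hg
  have hdet := comb_det_ne_zero hi hf hg
  obtain ⟨e1, e0, -, e2⟩ := bilin_coeff_eq_zero hχ
    (p := g₁ * χ₁ z₀ - (g₁ ^ 2 - f₁ ^ 2)) (q := -(g₁ * g₂ - f₁ * f₂))
    (q' := -(g₁ * g₂ - f₁ * f₂)) (r := g₂ * χ₂ z₀ - (g₂ ^ 2 - f₂ ^ 2)) fun x y => by
      have := h x y
      simp only [hf, hg, map_mul] at this
      linear_combination this
  have hg1 : g₁ ≠ 0 := by
    rintro rfl
    have : f₁ = 0 := pow_eq_zero_iff two_ne_zero |>.mp (by linear_combination e1)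
    simp [this] at hdet
  have hg2 : g₂ ≠ 0 := by
    rintro rfl
    have : f₂ = 0 := pow_eq_zero_iff two_ne_zero |>.mp (by linear_combination e2)
    simp [this] at hdet
  have hff : f₁ * f₂ ≠ 0 := by
    rw [show f₁ * f₂ = g₁ * g₂ by linear_combination e0]
    exact mul_ne_zero hg1 hg2
  have hf1 := left_ne_zero_of_mul hff
  have hf2 := right_ne_zero_of_mul hff
  -- `fᵢ` times the determinant is a multiple of `gᵢ² - fᵢ²`, because `f₁ f₂ = g₁ g₂`.
  have hd1 : g₁ ^ 2 - f₁ ^ 2 ≠ 0 := fun h0 => mul_ne_zero hf1 hdet (by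
    linear_combination -g₂ * h0 - g₁ * e0)
  have hd2 : g₂ ^ 2 - f₂ ^ 2 ≠ 0 := fun h0 => mul_ne_zero hf2 hdet (by
    linear_combination g₁ * h0 + g₂ * e0)
  have hz1 : χ₁ z₀ = (g₁ ^ 2 - f₁ ^ 2) / g₁ := by
    field_simp
    linear_combination e1
  have hz2 : χ₂ z₀ = (g₂ ^ 2 - f₂ ^ 2) / g₂ := by
    field_simp
    linear_combination e2
  have hne1 : χ₁ z₀ ≠ 0 := hz1 ▸ div_ne_zero hd1 hg1
  have hne2 : χ₂ z₀ ≠ 0 := hz2 ▸ div_ne_zero hd2 hg2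
  have hI := Complex.I_ne_zero
  have hI2 := Complex.I_sq
  have hinv : (-Complex.I * f₁ / g₁)⁻¹ = Complex.I * g₁ / f₁ := by
    field_simp
    linear_combination -hI2
  have hc : (-Complex.I * f₁ / g₁)⁻¹ + -Complex.I * f₁ / g₁ =
      Complex.I * ((g₁ ^ 2 - f₁ ^ 2) / (f₁ * g₁)) := by
    rw [hinv]
    field_simp
    ring
  have hIc : Complex.I * ((-Complex.I * f₁ / g₁)⁻¹ + -Complex.I * f₁ / g₁) =
      -((g₁ ^ 2 - f₁ ^ 2) / (f₁ * g₁)) := by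
    rw [hc]
    linear_combination (g₁ ^ 2 - f₁ ^ 2) / (f₁ * g₁) * hI2
  have hf2' : f₂ = g₁ * g₂ / f₁ := by
    field_simp
    linear_combination e0
  refine ⟨-Complex.I * f₁ / g₁, div_ne_zero (mul_ne_zero (neg_ne_zero.mpr hI) hf1) hg1,
    fun h0 => hd1 ?_, fun h0 => hd1 ?_, χ₁, χ₂, ?_, hne1, hne2, ?_, fun x => ?_, fun x => ?_⟩
  · field_simp at h0
    linear_combination (f₁ - g₁) * h0
  · field_simp at h0
    linear_combination (f₁ + g₁) * h0
  · rintro rfl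
    exact one_ne_zero (coeff_eq_zero hχ (s := 1) (t := -1) fun x => by ring).1
  · intro h0
    exact hne1 (coeff_eq_zero hχ (s := χ₁ z₀) (t := -χ₂ z₀)
      fun x => by linear_combination congrFun h0 x).1
  · rw [hf, hIc, hz1, hz2, hf2']
    field_simp
    ring
  · rw [hg, hc, hinv, hz1, hz2, hf2']
    field_simp
    ring

/-- Combinations of a multiplicative function and a solution of its sine addition law belong to
the eighth family. -/
theorem IsSolution.family8 {z₀ : S} (h : IsSolution z₀ f g)
    (hi : LinearIndependent ℂ ![f, g]) {χ : S →ₙ* ℂ} {ν : S → ℂ}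
    (hν : ∀ x y, ν (x * y) = ν x * χ y + χ x * ν y) {f₁ f₂ g₁ g₂ : ℂ}
    (hf : ∀ x, f x = f₁ * χ x + f₂ * ν x) (hg : ∀ x, g x = g₁ * χ x + g₂ * ν x) :
    Family8 z₀ f g := by
  have hχν := linearIndependent_of_comb hi hf hg
  have hdet := comb_det_ne_zero hi hf hg
  obtain ⟨e1, e0, -, e2⟩ := bilin_coeff_eq_zero hχν
    (p := g₁ * χ z₀ + g₂ * ν z₀ - (g₁ ^ 2 - f₁ ^ 2)) (q := g₂ * χ z₀ - (g₁ * g₂ - f₁ * f₂))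
    (q' := g₂ * χ z₀ - (g₁ * g₂ - f₁ * f₂)) (r := -(g₂ ^ 2 - f₂ ^ 2)) fun x y => by
      have := h x y
      simp only [hf, hg, hν, map_mul] at this
      linear_combination this
  have hf2 : f₂ ≠ 0 := by
    rintro rfl
    have : g₂ = 0 := pow_eq_zero_iff two_ne_zero |>.mp (by linear_combination -e2)
    simp [this] at hdet
  obtain ⟨s, hs, rfl⟩ : ∃ s : ℂ, (s = 1 ∨ s = -1) ∧ g₂ = s * f₂ := by
    rcases sq_eq_sq_iff_eq_or_eq_neg.mp (sub_eq_zero.mp (neg_eq_zero.mp e2)) with h | h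
    · exact ⟨1, Or.inl rfl, by rw [h, one_mul]⟩
    · exact ⟨-1, Or.inr rfl, by rw [h, neg_one_mul]⟩
  have hs2 : s ^ 2 = 1 := by rcases hs with rfl | rfl <;> norm_num
  have hz : χ z₀ = g₁ - s * f₁ :=
    mul_left_cancel₀ hf2 (by linear_combination s * e0 - f₂ * (χ z₀ - g₁) * hs2)
  have hz0 : χ z₀ ≠ 0 := fun h0 => hdet (by
    linear_combination f₂ * (hz - h0))
  have hA : f₂ * ν z₀ = f₁ * χ z₀ := by
    linear_combination s * e1 - (f₂ * ν z₀ - f₁ * χ z₀) * hs2 - (s * g₁ + f₁ * s ^ 2) * hz +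
      s * f₁ ^ 2 * hs2
  have hχ0 : ⇑χ ≠ 0 := fun h0 => hz0 (congrFun h0 z₀)
  have hν0 : (fun x => f₂ * ν x) ≠ 0 := fun h0 =>
    hf2 (coeff_eq_zero hχν (s := 0) (t := f₂) fun x => by
      have : f₂ * ν x = 0 := congrFun h0 x
      linear_combination this).2
  obtain ⟨hd, hpsi⟩ := exists_psi_eq hχ0 hν0 fun x y => by
    rw [hν]
    ring
  refine ⟨χ, _, _, hz0, s, hd, hs, fun x => ?_, fun x => ?_⟩ <;>
    rw [hpsi] <;> beta_reduce <;> rw [hA, mul_div_cancel_right₀ _ hz0]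
  · exact hf x
  · rw [hg, hz]
    ring

/-- With `(f, g)` expressed through the algebra `ℂ[t] / (t² - l t - κ)`, the multiplicative
functions `c + r k` for the roots `r` of the quadratic give the fourth family when the roots are
distinct; for a double root `k` satisfies the sine addition law. -/
theorem IsSolution.family_of_linearIndependent {z₀ : S} (h : IsSolution z₀ f g)
    (hi : LinearIndependent ℂ ![f, g]) : Family4 z₀ f g ∨ Family8 z₀ f g := by
  obtain ⟨c, k, κ, l, hc, hk, ⟨a, b, hf⟩, a', b', hg⟩ := h.exists_quadratic hi
  have hm : ∀ r : ℂ, r ^ 2 = l * r + κ → ∃ χ : S →ₙ* ℂ, ∀ x, χ x = c x + r * k x :=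
    fun r hr => ⟨⟨fun x => c x + r * k x, fun x y => by
      rw [hc, hk]
      linear_combination -(k x * k y) * hr⟩, fun _ => rfl⟩
  obtain ⟨d, hd⟩ := IsAlgClosed.exists_pow_nat_eq (l ^ 2 + 4 * κ) two_pos
  obtain ⟨χ₁, h1⟩ := hm ((l + d) / 2) (by linear_combination hd / 4)
  obtain ⟨χ₂, h2⟩ := hm ((l - d) / 2) (by linear_combination hd / 4)
  by_cases hd0 : d = 0
  · right
    subst hd0
    refine h.family8 hi (χ := χ₁) (ν := k) (fun x y => ?_) (f₁ := a) (f₂ := b - a * (l / 2))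
      (g₁ := a') (g₂ := b' - a' * (l / 2)) (fun x => ?_) (fun x => ?_)
    · rw [hk, h1, h1]
      ring
    · rw [hf, h1]
      ring
    · rw [hg, h1]
      ring
  · left
    have hkx : ∀ x, k x = (χ₁ x - χ₂ x) / d := fun x => by
      rw [h1, h2]
      field_simp
      ring
    have hcx : ∀ x, c x = χ₁ x - (l + d) / 2 * ((χ₁ x - χ₂ x) / d) := fun x => by
      rw [← hkx, h1]
      ring
    refine h.family4 hi (χ₁ := χ₁) (χ₂ := χ₂)
      (f₁ := a - (a * ((l + d) / 2) - b) / d) (f₂ := (a * ((l + d) / 2) - b) / d)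
      (g₁ := a' - (a' * ((l + d) / 2) - b') / d) (g₂ := (a' * ((l + d) / 2) - b') / d)
      (fun x => ?_) (fun x => ?_)
    · rw [hf, hcx, hkx]
      ring
    · rw [hg, hcx, hkx]
      ring

end Independent

end

end KannappanCosine

theorem theorem4p1 {S : Type*} [Semigroup S] (z₀ : S) (f g : S → ℂ) :
    (KannappanCosine.IsSolution z₀ f g ↔
      (KannappanCosine.Family1 f g ∨
        KannappanCosine.Family2 z₀ f g ∨
        (∃ d : ℂ, KannappanCosine.Family3 z₀ d f g) ∨
        KannappanCosine.Family4 z₀ f g ∨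
        KannappanCosine.Family5 z₀ f g ∨
        KannappanCosine.Family6 z₀ f g ∨
        KannappanCosine.Family7 z₀ f g ∨
        KannappanCosine.Family8 z₀ f g)) ∧
    (∀ [TopologicalSpace S] [ContinuousMul S], Continuous f →
      (KannappanCosine.Family1 f g → Continuous g) ∧
      (KannappanCosine.Family2 z₀ f g → Continuous g) ∧
      (∀ d : ℂ, d ≠ 0 → KannappanCosine.Family3 z₀ d f g → Continuous g) ∧
      (KannappanCosine.Family4 z₀ f g → Continuous g) ∧
      (KannappanCosine.Family5 z₀ f g → Continuous g) ∧
      (KannappanCosine.Family6 z₀ f g → Continuous g) ∧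
      (KannappanCosine.Family7 z₀ f g → Continuous g) ∧
      (KannappanCosine.Family8 z₀ f g → Continuous g)) := by
  refine ⟨⟨fun h => ?_, ?_⟩, ?_⟩
  · by_cases hi : LinearIndependent ℂ ![f, g]
    · rcases h.family_of_linearIndependent hi with h | h <;> tauto
    · rcases h.family_of_not_linearIndependent hi with h | h | h <;> tauto
  · rintro (h | h | ⟨d, h⟩ | h | h | h | h | h) <;> exact h.isSolution
  · intro _ _ hc
    exact ⟨fun h => h.2 ▸ continuous_zero, fun h => h.continuous hc,
      fun d hd h => h.continuous hd hc, fun h => h.continuous hc, fun h => h.continuous hc,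
      fun h => h.continuous hc, fun h => h.continuous hc, fun h => h.continuous hc⟩
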